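/- Let $Z$ be a compact Hausdorff space and let $((H_z)_{z\in Z},\Gamma)$ be a continuous field of complex Hilbert spaces over $Z$, that is, $\Gamma\subseteq\prod_{z\in Z}H_z$ is a linear subspace such that (a) $\{x(z):x\in\Gamma\}$ is dense in $H_z$ for every $z\in Z$; (b) $z\mapsto\|x(z)\|$ is continuous on $Z$ for every $x\in\Gamma$; (c) if $x\in\prod_{z\in Z}H_z$ and for every $t\in Z$ and every $\varepsilon>0$ there is an $x'\in\Gamma$ with $\|x'(s)-x(s)\|<\varepsilon$ for all $s$ in some neighborhood of $t$, then $x\in\Gamma$. View $\Gamma$ as a Hilbert $C(Z)$-module with the pointwise action $(xa)(z)=x(z)a(z)$ and the inner product $\langle x,y\rangle(z)=\langle x(z),y(z)\rangle$, linear in the second variable. Suppose that there are a countable subset $W\subseteq Z$ and a point $z_\infty\in\overline W\setminus W$ such that $H_z$ is separable for every $z\in W$ while $H_{z_\infty}$ is nonseparable. Then $\Gamma$ has no frame: there is no family $(x_j)_{j\in J}$ in $\Gamma$, over any index set $J$, for which there is a real constant $C>0$ such that for every $x\in\Gamma$ the sum $\sum_{j\in J}\langle x,x_j\rangle\langle x_j,x\rangle$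 (the limit of the net of its finite partial sums) converges in the ultraweak operator topology to some element of the universal enveloping von Neumann algebra $C(Z)^{**}$ of $C(Z)$ and $$C\,\langle x,x\rangle\le\sum_{j\in J}\langle x,x_j\rangle\langle x_j,x\rangle\le C^{-1}\langle x,x\rangle\quad\text{in }C(Z)^{**}.$$ -/

import Mathlib

open scoped ComplexOrder InnerProductSpace Topology ENNReal
open Filter

noncomputable section

/-! ## Continuous fields of Banach and Hilbert spaces -/

/-- A continuous field of complex Banach spaces `(H_t)` over a topological space `T`: a linear space
of sections with dense evaluations and continuous norm functions that contains every section
which is locally uniformly approximable by its members.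
It is a continuous field of Hilbert spaces when every `H t` is a Hilbert space. -/
structure ContinuousField (T : Type*) [TopologicalSpace T] (H : T → Type*)
    [∀ t, NormedAddCommGroup (H t)] [∀ t, NormedSpace ℂ (H t)] [∀ t, CompleteSpace (H t)] where
  /-- the linear subspace `Γ` of the product of the fibres -/
  carrier : Submodule ℂ (∀ t, H t)
  dense_eval : ∀ t, Dense {v : H t | ∃ x ∈ carrier, x t = v}
  continuous_norm : ∀ x ∈ carrier, Continuous fun t => ‖x t‖
  locally_closed : ∀ x : (∀ t, H t),
    (∀ t, ∀ ε : ℝ, 0 < ε → ∃ x' ∈ carrier, ∀ᶠ s in 𝓝 t, ‖x' s - x s‖ < ε) → x ∈ carrier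

namespace ContinuousField

section Module

variable {Z : Type*} [TopologicalSpace Z] {H : Z → Type*}
  [∀ z, NormedAddCommGroup (H z)] [∀ z, InnerProductSpace ℂ (H z)] [∀ z, CompleteSpace (H z)]

/-- The space `Γ` of a continuous field of Hilbert spaces, as a type of its own: it will carry the
norm of a Hilbert `C(Z)`-module and not the topology of pointwise convergence. -/
def Sections (Γ : ContinuousField Z H) : Type _ := Γ.carrier

variable {Γ : ContinuousField Z H}

instance : AddCommGroup Γ.Sections := inferInstanceAs (AddCommGroup Γ.carrier)
instance : Module ℂ Γ.Sections := inferInstanceAs (Module ℂ Γ.carrier)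

/-- Elements of `Γ` are functions on `Z`. -/
instance : DFunLike Γ.Sections Z H where
  coe x := Subtype.val (p := fun x => x ∈ Γ.carrier) x
  coe_injective := Subtype.val_injective

namespace Sections

theorem coe_mem (x : Γ.Sections) : (fun z => x z) ∈ Γ.carrier :=
  Subtype.property (p := fun x => x ∈ Γ.carrier) x

/-- A member of the space of sections, as an element of the type `Γ.Sections`. -/
def mk (x : ∀ z, H z) (hx : x ∈ Γ.carrier) : Γ.Sections := (⟨x, hx⟩ : Γ.carrier)

@[simp] theorem mk_apply (x : ∀ z, H z) (hx : x ∈ Γ.carrier) (z : Z) :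
    (mk x hx : Γ.Sections) z = x z := rfl

@[ext] theorem ext {x y : Γ.Sections} (h : ∀ z, x z = y z) : x = y := DFunLike.ext x y h

@[simp] theorem add_apply (x y : Γ.Sections) (z : Z) : (x + y) z = x z + y z := rfl
@[simp] theorem sub_apply (x y : Γ.Sections) (z : Z) : (x - y) z = x z - y z := rfl
@[simp] theorem zero_apply (z : Z) : (0 : Γ.Sections) z = 0 := rfl
@[simp] theorem smul_apply (c : ℂ) (x : Γ.Sections) (z : Z) : (c • x) z = c • x z := rfl

theorem continuous_norm (x : Γ.Sections) : Continuous fun z => ‖x z‖ :=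
  Γ.continuous_norm _ x.coe_mem

theorem continuous_inner (x y : Γ.Sections) : Continuous fun z => ⟪x z, y z⟫_ℂ := by
  have h : ∀ z, ⟪x z, y z⟫_ℂ = ((‖(x + y) z‖ : ℂ) ^ 2 - (‖(x - y) z‖ : ℂ) ^ 2 +
      ((‖(x - Complex.I • y) z‖ : ℂ) ^ 2 - (‖(x + Complex.I • y) z‖ : ℂ) ^ 2) * Complex.I) / 4 :=
    fun z => inner_eq_sum_norm_sq_div_four (𝕜 := ℂ) (x z) (y z)
  simp_rw [h]
  have h1 := (x + y).continuous_norm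
  have h2 := (x - y).continuous_norm
  have h3 := (x - Complex.I • y).continuous_norm
  have h4 := (x + Complex.I • y).continuous_norm
  fun_prop

/-- The pointwise action of `C(Z)` on `Γ`. -/
instance : SMul C(Z, ℂ) Γ.Sections where
  smul a x := mk (fun z => a z • x z) <| by
    refine Γ.locally_closed _ fun t ε hε =>
      ⟨a t • fun z => x z, Γ.carrier.smul_mem _ x.coe_mem, ?_⟩
    have hc : Continuous fun s => ‖a t - a s‖ * ‖x s‖ :=
      (by fun_prop : Continuous fun s => ‖a t - a s‖).mul x.continuous_norm
    have h0 : Tendsto (fun s => ‖a t - a s‖ * ‖x s‖) (𝓝 t) (𝓝 0) := by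
      simpa using hc.tendsto t
    filter_upwards [h0.eventually (gt_mem_nhds hε)] with s hs
    rw [Pi.smul_apply, ← sub_smul, norm_smul]
    exact hs

@[simp] theorem cont_smul_apply (a : C(Z, ℂ)) (x : Γ.Sections) (z : Z) :
    (a • x) z = a z • x z := rfl

instance : Module C(Z, ℂ) Γ.Sections where
  one_smul x := by ext z; simp
  mul_smul a b x := by ext z; simp [mul_smul]
  smul_zero a := by ext z; simp
  smul_add a x y := by ext z; simp
  add_smul a b x := by ext z; simp [add_smul]
  zero_smul x := by ext z; simp

/-- The pointwise `C(Z)`-valued inner product on `Γ`, linear in the second variable. -/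
instance : Inner C(Z, ℂ) Γ.Sections where
  inner x y := ⟨fun z => ⟪x z, y z⟫_ℂ, continuous_inner x y⟩

@[simp] theorem inner_apply (x y : Γ.Sections) (z : Z) :
    (inner C(Z, ℂ) x y) z = ⟪x z, y z⟫_ℂ := rfl

variable [CompactSpace Z]

/-- The norm of a Hilbert module, `‖x‖ = ‖⟨x, x⟩‖ ^ (1/2)`; it is the supremum norm. -/
instance : Norm Γ.Sections where
  norm x := √‖inner C(Z, ℂ) x x‖

theorem norm_le_iff (x : Γ.Sections) {c : ℝ} (hc : 0 ≤ c) : ‖x‖ ≤ c ↔ ∀ z, ‖x z‖ ≤ c := by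
  change √‖inner C(Z, ℂ) x x‖ ≤ c ↔ _
  rw [Real.sqrt_le_left hc, ContinuousMap.norm_le _ (by positivity)]
  refine forall_congr' fun z => ?_
  rw [inner_apply, inner_self_eq_norm_sq_to_K, norm_pow, RCLike.norm_ofReal, abs_norm]
  exact sq_le_sq₀ (norm_nonneg _) hc

theorem norm_apply_le (x : Γ.Sections) (z : Z) : ‖x z‖ ≤ ‖x‖ :=
  (norm_le_iff x (Real.sqrt_nonneg _)).1 le_rfl z

/-- `Γ` as a pre-Hilbert `C(Z)`-module. -/
instance : CStarModule C(Z, ℂ) Γ.Sections where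
  inner_add_right := by intro x y w; ext z; simp
  inner_self_nonneg := by
    intro x z
    change (0 : ℂ) ≤ ⟪x z, x z⟫_ℂ
    rw [inner_self_eq_norm_sq_to_K]
    exact Complex.zero_le_real.2 (norm_nonneg (x z)) |> fun h => pow_nonneg h 2
  inner_self := by
    intro x
    refine ⟨fun h => ?_, fun h => ?_⟩
    · ext z
      have := congrArg (fun f : C(Z, ℂ) => f z) h
      simpa using this
    · ext z; simp [h]
  inner_op_smul_right := by intro a x y; ext z; simp
  inner_smul_right_complex := by intro c x y; ext z; simp
  star_inner x y := by ext z; simp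
  norm_eq_sqrt_norm_inner_self x := rfl

instance : NormedAddCommGroup Γ.Sections :=
  NormedAddCommGroup.ofCore (CStarModule.normedSpaceCore C(Z, ℂ))

instance : NormedSpace ℂ Γ.Sections :=
  NormedSpace.ofCore (CStarModule.normedSpaceCore C(Z, ℂ))

/-- `Γ` is complete, so that it is a Hilbert `C(Z)`-module. -/
instance : CompleteSpace Γ.Sections := by
  refine Metric.complete_of_cauchySeq_tendsto fun u hu => ?_
  have hpt : ∀ z, CauchySeq fun n => u n z := by
    intro z
    rw [Metric.cauchySeq_iff] at hu ⊢
    intro ε hε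
    obtain ⟨N, hN⟩ := hu ε hε
    refine ⟨N, fun m hm n hn => ?_⟩
    have h := hN m hm n hn
    rw [dist_eq_norm] at h ⊢
    exact (norm_apply_le (u m - u n) z).trans_lt h
  choose x hx using fun z => cauchySeq_tendsto_of_complete (hpt z)
  have hunif : ∀ ε : ℝ, 0 < ε → ∃ N, ∀ n ≥ N, ∀ z, ‖u n z - x z‖ ≤ ε := by
    intro ε hε
    obtain ⟨N, hN⟩ := Metric.cauchySeq_iff.1 hu ε hε
    refine ⟨N, fun n hn z => ?_⟩
    refine le_of_tendsto ((tendsto_const_nhds (x := u n z)).sub (hx z)).norm ?_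
    filter_upwards [eventually_ge_atTop N] with m hm
    have h := hN n hn m hm
    rw [dist_eq_norm] at h
    exact (norm_apply_le (u n - u m) z).trans h.le
  have hmem : x ∈ Γ.carrier := by
    refine Γ.locally_closed x fun t ε hε => ?_
    obtain ⟨N, hN⟩ := hunif (ε / 2) (half_pos hε)
    exact ⟨fun z => u N z, (u N).coe_mem, Eventually.of_forall fun s =>
      (hN N le_rfl s).trans_lt (half_lt_self hε)⟩
  refine ⟨mk x hmem, ?_⟩
  rw [Metric.tendsto_atTop]
  intro ε hε
  obtain ⟨N, hN⟩ := hunif (ε / 2) (half_pos hε)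
  refine ⟨N, fun n hn => ?_⟩
  rw [dist_eq_norm]
  refine lt_of_le_of_lt ?_ (half_lt_self hε)
  exact (norm_le_iff _ (half_pos hε).le).2 fun z => hN n hn z

end Sections

end Module

end ContinuousField

/-! ## The universal enveloping von Neumann algebra -/

section Enveloping

variable (A : Type*) [CStarAlgebra A] [PartialOrder A] [StarOrderedRing A]

/-- The states of a unital C*-algebra. -/
abbrev CStarState : Type _ := {φ : A →ₚ[ℂ] ℂ // φ 1 = 1}

variable {A} in
/-- The Hilbert space of the GNS representation of a state. -/
def GNSSpace (φ : CStarState A) : Type _ := φ.1.GNS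

section

variable {A} (φ : CStarState A)

instance : NormedAddCommGroup (GNSSpace φ) := inferInstanceAs (NormedAddCommGroup φ.1.GNS)
instance : InnerProductSpace ℂ (GNSSpace φ) := inferInstanceAs (InnerProductSpace ℂ φ.1.GNS)
instance : CompleteSpace (GNSSpace φ) := inferInstanceAs (CompleteSpace φ.1.GNS)

/-- The GNS representation of a state. -/
def gnsRep : A →⋆ₐ[ℂ] (GNSSpace φ →L[ℂ] GNSSpace φ) := φ.1.gnsStarAlgHom

end

/-- The Hilbert space of the universal representation: the Hilbert sum of the GNS spaces of all
states. -/
abbrev UniversalSpace : Type _ := lp (fun φ : CStarState A => GNSSpace φ) 2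

variable {A}

theorem norm_gns_apply_le (φ : CStarState A) (a : A) (v : GNSSpace φ) :
    ‖gnsRep φ a v‖ ≤ ‖a‖ * ‖v‖ :=
  (ContinuousLinearMap.le_opNorm _ v).trans
    (mul_le_mul_of_nonneg_right (NonUnitalStarAlgHom.norm_apply_le (gnsRep φ) a)
      (norm_nonneg v))

theorem memℓp_gns_apply (a : A) (v : UniversalSpace A) :
    Memℓp (fun φ : CStarState A => gnsRep φ a (v φ)) 2 := by
  have hp : (0 : ℝ) < (2 : ℝ≥0∞).toReal := by norm_num
  refine memℓp_gen (Summable.of_nonneg_of_le (fun φ => by positivity) (fun φ => ?_)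
    (((lp.memℓp v).summable hp).mul_left (‖a‖ ^ (2 : ℝ≥0∞).toReal)))
  rw [← Real.mul_rpow (norm_nonneg _) (norm_nonneg _)]
  exact Real.rpow_le_rpow (norm_nonneg _) (norm_gns_apply_le φ a (v φ)) hp.le

/-- The operator by which `a` acts on the universal space: the direct sum of its GNS operators. -/
def universalRepOp (a : A) : UniversalSpace A →L[ℂ] UniversalSpace A :=
  LinearMap.mkContinuous
    { toFun := fun v => ⟨fun φ => gnsRep φ a (v φ), memℓp_gns_apply a v⟩
      map_add' := fun v w => by ext φ : 2; exact map_add (gnsRep φ a) (v φ) (w φ)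
      map_smul' := fun c v => by ext φ : 2; exact map_smul (gnsRep φ a) c (v φ) }
    ‖a‖ fun v => by
      refine lp.norm_le_of_forall_sum_le (by norm_num) (by positivity) fun s => ?_
      have hp : (0 : ℝ) < (2 : ℝ≥0∞).toReal := by norm_num
      rw [Real.mul_rpow (norm_nonneg _) (norm_nonneg _)]
      calc ∑ φ ∈ s, ‖gnsRep φ a (v φ)‖ ^ (2 : ℝ≥0∞).toReal
          ≤ ∑ φ ∈ s, ‖a‖ ^ (2 : ℝ≥0∞).toReal * ‖v φ‖ ^ (2 : ℝ≥0∞).toReal := by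
            refine Finset.sum_le_sum fun φ _ => ?_
            rw [← Real.mul_rpow (norm_nonneg _) (norm_nonneg _)]
            exact Real.rpow_le_rpow (norm_nonneg _) (norm_gns_apply_le φ a (v φ)) hp.le
        _ = ‖a‖ ^ (2 : ℝ≥0∞).toReal * ∑ φ ∈ s, ‖v φ‖ ^ (2 : ℝ≥0∞).toReal :=
            (Finset.mul_sum _ _ _).symm
        _ ≤ _ := mul_le_mul_of_nonneg_left (lp.sum_rpow_le_norm_rpow hp v s) (by positivity)

@[simp] theorem universalRepOp_apply (a : A) (v : UniversalSpace A) (φ : CStarState A) :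
    universalRepOp a v φ = gnsRep φ a (v φ) := rfl

variable (A) in
/-- The universal representation of a unital C*-algebra: the direct sum of the GNS representations
of all its states. -/
def universalRep : A →⋆ₐ[ℂ] (UniversalSpace A →L[ℂ] UniversalSpace A) where
  toFun := universalRepOp
  map_one' := by
    ext v φ : 3
    rw [universalRepOp_apply, map_one]; rfl
  map_mul' a b := by
    ext v φ : 3
    rw [universalRepOp_apply, map_mul]; rfl
  map_zero' := by
    ext v φ : 3
    rw [universalRepOp_apply, map_zero]; rfl
  map_add' a b := by
    ext v φ : 3
    rw [universalRepOp_apply, map_add]; rfl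
  commutes' c := by
    ext v φ : 3
    rw [universalRepOp_apply, AlgHomClass.commutes, Algebra.algebraMap_eq_smul_one,
      Algebra.algebraMap_eq_smul_one]; rfl
  map_star' a := by
    rw [ContinuousLinearMap.star_eq_adjoint, ContinuousLinearMap.eq_adjoint_iff]
    intro v w
    rw [lp.inner_eq_tsum, lp.inner_eq_tsum]
    refine tsum_congr fun φ => ?_
    rw [universalRepOp_apply, universalRepOp_apply, map_star,
      ContinuousLinearMap.star_eq_adjoint, ContinuousLinearMap.adjoint_inner_left]

variable (A) in
/-- The universal enveloping von Neumann algebra `A**` of a unital C*-algebra: the von Neumann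
algebra generated by (that is, the double commutant of) the image of the universal
representation. -/
def envelopingVonNeumannAlgebra : VonNeumannAlgebra (UniversalSpace A) where
  toStarSubalgebra := StarSubalgebra.centralizer ℂ
    (StarSubalgebra.centralizer ℂ
      (Set.range (universalRep A)) :
        Set (UniversalSpace A →L[ℂ] UniversalSpace A))
  centralizer_centralizer' := by
    simp [StarSubalgebra.centralizer]

theorem coe_envelopingVonNeumannAlgebra :
    (envelopingVonNeumannAlgebra A : Set (UniversalSpace A →L[ℂ] UniversalSpace A)) =
      Set.centralizer (Set.centralizer (Set.range (universalRep A))) := by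
  have h : star (Set.range (universalRep A)) = Set.range (universalRep A) := by
    ext T
    constructor
    · rintro ⟨a, ha⟩
      exact ⟨star a, by rw [map_star, ha, star_star]⟩
    · rintro ⟨a, rfl⟩
      exact ⟨star a, map_star _ _⟩
  rw [← VonNeumannAlgebra.coe_toStarSubalgebra]
  simp only [envelopingVonNeumannAlgebra, StarSubalgebra.coe_centralizer, h, Set.union_self,
    Set.star_centralizer]

end Enveloping

/-- The ultraweak operator topology on the bounded operators of a Hilbert space: the coarsest one
for which all functionals `T ↦ ∑ₙ ⟨ξₙ, T ηₙ⟩` with `∑ₙ ‖ξₙ‖² < ∞` and `∑ₙ ‖ηₙ‖² < ∞` are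
continuous. -/
@[reducible] def ultraweakTopology (H : Type*) [NormedAddCommGroup H] [InnerProductSpace ℂ H] :
    TopologicalSpace (H →L[ℂ] H) :=
  ⨅ (ξ : ℕ → H) (η : ℕ → H) (_ : Summable fun n => ‖ξ n‖ ^ 2) (_ : Summable fun n => ‖η n‖ ^ 2),
    TopologicalSpace.induced (fun T : H →L[ℂ] H => ∑' n, ⟪ξ n, T (η n)⟫_ℂ) inferInstance

/-! ## Frames -/

/-- A family `(x_j)` in a Hilbert module `X` over a commutative unital C*-algebra `A` is a frame if,
for some constant `C > 0` and all `y`, the sums of `⟨y, x_j⟩ ⟨x_j, y⟩` over the finite subsets of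
the index set converge ultraweakly to an element `S` of the enveloping von Neumann algebra, and
`C ⟨y, y⟩ ≤ S ≤ C⁻¹ ⟨y, y⟩` there.
As `A` is commutative, left and right `A`-modules are the same thing. -/
def IsFrame (A : Type*) [CommCStarAlgebra A] [PartialOrder A] [StarOrderedRing A]
    {X : Type*} [NormedAddCommGroup X] [NormedSpace ℂ X] [CompleteSpace X] [Module A X]
    [CStarModule A X] {J : Type*} (x : J → X) : Prop :=
  ∃ C : ℝ, 0 < C ∧ ∀ y : X, ∃ S ∈ envelopingVonNeumannAlgebra A,
    Tendsto (fun F : Finset J => ∑ j ∈ F, universalRep A (inner A y (x j) * inner A (x j) y)) atTop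
      (@nhds _ (ultraweakTopology (UniversalSpace A)) S) ∧
    (C : ℂ) • universalRep A (inner A y y) ≤ S ∧
    S ≤ ((C⁻¹ : ℝ) : ℂ) • universalRep A (inner A y y)

end

/-! A frame of `Γ` restricts, at every point `z`, to a family in `H z` satisfying both frame
inequalities against the values of sections: evaluation at `z` is a vector state of the universal
representation, hence ultraweakly continuous and monotone, so it carries the sums and inequalities
in `C(Z)**` to numbers.

In a separable fibre the upper (Bessel) bound leaves only countably many nonzero `x j z`. As `W` is
countable, all but countably many `x j` vanish on the whole of `W`, and by continuity of the norm
they vanish at `z_inf` too. The lower bound then forces the countably many remaining vectors `x j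
z_inf` to span a dense subspace, so `H z_inf` would be separable. -/

/-! ### From operator inequalities to the fibres -/

section VectorState

variable {A : Type*} [CStarAlgebra A] [PartialOrder A] [StarOrderedRing A]

/-- Every state of a C*-algebra is a vector state in its GNS representation. -/
theorem exists_gns_vector (φ : CStarState A) :
    ∃ v : GNSSpace φ, ∀ a : A, ⟪v, gnsRep φ a v⟫_ℂ = φ.1 a := by
  -- The cyclic vector is the class of `1`; `a` moves it to the class of `a`, whose pairing with it
  -- is `φ (star 1 * a)`.
  refine ⟨((φ.1.toPreGNS 1 : φ.1.PreGNS) : φ.1.GNS), fun a => ?_⟩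
  have h : gnsRep φ a ((φ.1.toPreGNS 1 : φ.1.PreGNS) : φ.1.GNS) =
      ((φ.1.toPreGNS a : φ.1.PreGNS) : φ.1.GNS) := by
    refine (PositiveLinearMap.gnsNonUnitalStarAlgHom_apply_coe φ.1).trans ?_
    simp
  rw [h]
  refine (UniformSpace.Completion.inner_coe (𝕜 := ℂ) (φ.1.toPreGNS 1) (φ.1.toPreGNS a)).trans ?_
  simp [PositiveLinearMap.preGNS_inner_def]

/-- Every state of a C*-algebra is a vector state in the universal representation. -/
theorem exists_universal_vector (φ : CStarState A) :
    ∃ v : UniversalSpace A, ∀ a : A, ⟪v, universalRep A a v⟫_ℂ = φ.1 a := by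
  classical
  obtain ⟨v, hv⟩ := exists_gns_vector φ
  refine ⟨lp.single 2 φ v, fun a => ?_⟩
  rw [lp.inner_single_left]
  change ⟪v, gnsRep φ a ((lp.single 2 φ v : UniversalSpace A) φ)⟫_ℂ = _
  rw [lp.single_apply_self, hv]

end VectorState

/-- Vector functionals are continuous for the ultraweak topology. -/
theorem continuous_ultraweak_vector_state {E : Type*} [NormedAddCommGroup E]
    [InnerProductSpace ℂ E] (v : E) :
    @Continuous _ _ (ultraweakTopology E) _ fun T : E →L[ℂ] E => ⟪v, T v⟫_ℂ := by
  -- A sequence with the single nonzero term `v` reduces the defining series to one vector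
  -- functional.
  let ξ : ℕ → E := Pi.single 0 v
  have hξ : Summable fun n => ‖ξ n‖ ^ 2 :=
    summable_of_ne_finset_zero (s := {0}) fun n hn => by
      simp [ξ, Pi.single_eq_of_ne (Finset.notMem_singleton.1 hn)]
  have hsum : (fun T : E →L[ℂ] E => ∑' n, ⟪ξ n, T (ξ n)⟫_ℂ) = fun T => ⟪v, T v⟫_ℂ := by
    funext T
    rw [tsum_eq_single 0 fun n hn => by simp [ξ, Pi.single_eq_of_ne hn]]
    simp [ξ]
  rw [← hsum, continuous_iff_le_induced]
  exact iInf_le_of_le ξ (iInf_le_of_le ξ (iInf_le_of_le hξ (iInf_le _ hξ)))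

/-- Evaluation at a point, as a state of `C(Z)`. -/
noncomputable def evalState {Z : Type*} [TopologicalSpace Z] [CompactSpace Z] (z : Z) :
    CStarState C(Z, ℂ) :=
  ⟨PositiveLinearMap.mk₀
    { toFun := fun a => a z, map_add' := fun _ _ => rfl, map_smul' := fun _ _ => rfl }
    fun _ ha => ha z, rfl⟩

/-- The operator inequalities of a frame hold pointwise, for the fibres. -/
theorem IsFrame.exists_hasSum_apply {Z : Type*} [TopologicalSpace Z] [CompactSpace Z]
    {H : Z → Type*} [∀ z, NormedAddCommGroup (H z)] [∀ z, InnerProductSpace ℂ (H z)]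
    [∀ z, CompleteSpace (H z)] {Γ : ContinuousField Z H} {J : Type*} {x : J → Γ.Sections}
    (hx : IsFrame C(Z, ℂ) x) :
    ∃ C : ℝ, 0 < C ∧ ∀ (y : Γ.Sections) (z : Z), ∃ s : ℝ,
      HasSum (fun j => ‖⟪x j z, y z⟫_ℂ‖ ^ 2) s ∧ C * ‖y z‖ ^ 2 ≤ s ∧ s ≤ C⁻¹ * ‖y z‖ ^ 2 := by
  obtain ⟨C, hC, h⟩ := hx
  refine ⟨C, hC, fun y z => ?_⟩
  obtain ⟨S, -, hS, hle, hge⟩ := h y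
  obtain ⟨v, hv⟩ := exists_universal_vector (evalState z)
  replace hv : ∀ a : C(Z, ℂ), ⟪v, universalRep C(Z, ℂ) a v⟫_ℂ = a z := hv
  -- Pairing with `v` turns ultraweak convergence of the partial sums into convergence of their
  -- values at `z`.
  have hlim := (@Continuous.tendsto _ _ (ultraweakTopology _) _ _
    (continuous_ultraweak_vector_state v) S).comp hS
  have hyy : (inner C(Z, ℂ) y y) z = ((‖y z‖ ^ 2 : ℝ) : ℂ) := by
    simp [inner_self_eq_norm_sq_to_K]
  have hterm : ∀ j, (inner C(Z, ℂ) y (x j) * inner C(Z, ℂ) (x j) y) z =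
      ((‖⟪x j z, y z⟫_ℂ‖ ^ 2 : ℝ) : ℂ) := fun j => by
    rw [ContinuousMap.mul_apply, ContinuousField.Sections.inner_apply,
      ContinuousField.Sections.inner_apply, ← inner_conj_symm (y z), Complex.conj_mul']
    push_cast; rfl
  refine ⟨(⟪v, S v⟫_ℂ).re, ?_, ?_, ?_⟩
  · refine ((Complex.continuous_re.tendsto _).comp hlim).congr fun F => ?_
    simp only [Function.comp_apply, _root_.sum_apply, inner_sum, hv, hterm]
    rw [← Complex.ofReal_sum, Complex.ofReal_re]
  -- The operator order means that the difference is positive, so its quadratic form at `v` is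
  -- nonnegative.
  · have := (ContinuousLinearMap.le_def _ _).1 hle |>.re_inner_nonneg_right v
    rw [_root_.sub_apply, _root_.smul_apply, inner_sub_right,
      inner_smul_right, hv, hyy, ← Complex.ofReal_mul] at this
    simpa [-Complex.ofReal_pow, -Complex.ofReal_mul] using this
  · have := (ContinuousLinearMap.le_def _ _).1 hge |>.re_inner_nonneg_right v
    rw [_root_.sub_apply, _root_.smul_apply, inner_sub_right,
      inner_smul_right, hv, hyy, ← Complex.ofReal_mul] at this
    simpa [-Complex.ofReal_pow, -Complex.ofReal_mul] using this

/-! ### Bessel families in a Hilbert space -/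

section HilbertFamily

variable {E : Type*} [NormedAddCommGroup E] [InnerProductSpace ℂ E] {J : Type*} {f : J → E}

/-- A Bessel bound on a dense set is a Bessel bound everywhere. -/
theorem sum_norm_inner_sq_le_of_dense {D : Set E} (hD : Dense D) {B : ℝ}
    (h : ∀ v ∈ D, ∀ F : Finset J, ∑ j ∈ F, ‖⟪f j, v⟫_ℂ‖ ^ 2 ≤ B * ‖v‖ ^ 2)
    (F : Finset J) (v : E) : ∑ j ∈ F, ‖⟪f j, v⟫_ℂ‖ ^ 2 ≤ B * ‖v‖ ^ 2 := by
  -- Both sides are continuous in `v` because `F` is finite.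
  have hcl : IsClosed {v : E | ∑ j ∈ F, ‖⟪f j, v⟫_ℂ‖ ^ 2 ≤ B * ‖v‖ ^ 2} :=
    isClosed_le (by fun_prop) (by fun_prop)
  exact hD.induction (fun v hv => h v hv F) hcl v

/-- A Bessel family in a separable space has only countably many nonzero members. -/
theorem countable_setOf_ne_zero_of_bessel [TopologicalSpace.SeparableSpace E] {B : ℝ}
    (h : ∀ (F : Finset J) (v : E), ∑ j ∈ F, ‖⟪f j, v⟫_ℂ‖ ^ 2 ≤ B * ‖v‖ ^ 2) :
    {j | f j ≠ 0}.Countable := by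
  obtain ⟨D, hDc, hD⟩ := TopologicalSpace.exists_countable_dense E
  -- Each `v ∈ D` pairs nontrivially with only countably many `f j`, and an `f j` orthogonal to all
  -- of `D` is zero.
  refine (hDc.biUnion fun v _ => (summable_of_sum_le (f := fun j => ‖⟪f j, v⟫_ℂ‖ ^ 2)
    (fun j => by positivity) fun F => h F v).countable_support).mono fun j hj => ?_
  by_contra hn
  refine hj (hD.eq_zero_of_inner_right ℂ fun {v} hv => ?_)
  by_contra hne
  exact hn (Set.mem_biUnion hv (by simpa using mt inner_eq_zero_symm.1 hne))

/-- A Bessel family with countably many nonzero members and a lower frame bound on a dense set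
can live only in a separable space. -/
theorem separableSpace_of_countable_frame [CompleteSpace E] (hc : {j | f j ≠ 0}.Countable)
    {D : Set E} (hD : Dense D) {B C : ℝ} (hC : 0 < C)
    (hB : ∀ (F : Finset J) (v : E), ∑ j ∈ F, ‖⟪f j, v⟫_ℂ‖ ^ 2 ≤ B * ‖v‖ ^ 2)
    (hlow : ∀ v ∈ D, C * ‖v‖ ^ 2 ≤ ∑' j, ‖⟪f j, v⟫_ℂ‖ ^ 2) :
    TopologicalSpace.SeparableSpace E := by
  have hM : TopologicalSpace.IsSeparable (Submodule.span ℂ (f '' {j | f j ≠ 0}) : Set E) :=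
    (hc.image f).isSeparable.span
  suffices (Submodule.span ℂ (f '' {j | f j ≠ 0})).topologicalClosure = ⊤ by
    rw [← TopologicalSpace.isSeparable_univ_iff, ← Submodule.top_coe (R := ℂ), ← this]
    exact hM.closure
  rw [Submodule.topologicalClosure_eq_top_iff, Submodule.eq_bot_iff]
  intro v hv
  have horth : ∀ j, ⟪f j, v⟫_ℂ = 0 := fun j => by
    by_cases hj : f j = 0
    · simp [hj]
    · exact (Submodule.mem_orthogonal _ _).1 hv _ (Submodule.subset_span ⟨j, hj, rfl⟩)
  -- The lower bound is known only on `D`, which need not contain `v`. Since `v` is orthogonal to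
  -- every `f j`, the coefficients of `d` and `d - v` agree, and the Bessel bound for `d - v` yields
  -- an inequality continuous in `d`, which can be taken at `d = v`.
  have key : ∀ d : E, C * ‖d‖ ^ 2 ≤ B * ‖d - v‖ ^ 2 := by
    refine hD.induction (fun d hd => (hlow d hd).trans ?_)
      (isClosed_le (by fun_prop) (by fun_prop))
    have hle := Real.tsum_le_of_sum_le (f := fun j => ‖⟪f j, d - v⟫_ℂ‖ ^ 2)
      (fun j => by positivity) fun F => hB F (d - v)
    simpa only [inner_sub_right, horth, sub_zero] using hle
  have h0 : C * ‖v‖ ^ 2 ≤ 0 := by simpa using key v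
  have : ‖v‖ ^ 2 ≤ 0 := nonpos_of_mul_nonpos_right h0 hC
  simpa using this.antisymm (sq_nonneg _)

end HilbertFamily

/-! ### Transfer from `W` to the limit point -/

theorem lemma3p2 {Z : Type*} [TopologicalSpace Z] [CompactSpace Z] [T2Space Z] {H : Z → Type*}
    [∀ z, NormedAddCommGroup (H z)] [∀ z, InnerProductSpace ℂ (H z)] [∀ z, CompleteSpace (H z)]
    (Γ : ContinuousField Z H) (W : Set Z) (hW : W.Countable) (z_inf : Z)
    (hz : z_inf ∈ closure W \ W)
    (hsep : ∀ z ∈ W, TopologicalSpace.SeparableSpace (H z))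
    (hnonsep : ¬ TopologicalSpace.SeparableSpace (H z_inf)) :
    ¬ ∃ (J : Type*) (x : J → Γ.Sections), IsFrame C(Z, ℂ) x := by
  rintro ⟨J, x, hx⟩
  obtain ⟨C, hC, h⟩ := hx.exists_hasSum_apply
  -- The frame condition speaks only of values of sections; these are dense in each fibre.
  have hbessel : ∀ (z : Z) (F : Finset J) (v : H z),
      ∑ j ∈ F, ‖⟪x j z, v⟫_ℂ‖ ^ 2 ≤ C⁻¹ * ‖v‖ ^ 2 := fun z => by
    refine sum_norm_inner_sq_le_of_dense (Γ.dense_eval z) ?_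
    rintro _ ⟨y, hy, rfl⟩ F
    obtain ⟨s, hs, -, hle⟩ := h (ContinuousField.Sections.mk y hy) z
    exact (sum_le_hasSum F (fun j _ => by positivity) hs).trans hle
  have hcount : (⋃ z ∈ W, {j | x j z ≠ 0}).Countable := hW.biUnion fun z hzW =>
    have := hsep z hzW
    countable_setOf_ne_zero_of_bessel (hbessel z)
  have hcount_inf : {j | x j z_inf ≠ 0}.Countable := hcount.mono fun j hj => by
    by_contra hn
    refine hj (norm_eq_zero.1 ?_)
    -- The zero set of a section is closed, so vanishing on `W` passes to its closure.
    have hcl : IsClosed {z | ‖x j z‖ = 0} := isClosed_eq (x j).continuous_norm continuous_const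
    refine closure_minimal (fun z hzW => ?_) hcl hz.1
    by_contra hne
    exact hn (Set.mem_biUnion hzW fun h0 => hne (by simp [h0]))
  refine hnonsep (separableSpace_of_countable_frame hcount_inf (Γ.dense_eval z_inf) hC
    (hbessel z_inf) ?_)
  rintro _ ⟨y, hy, rfl⟩
  obtain ⟨s, hs, hle, -⟩ := h (ContinuousField.Sections.mk y hy) z_inf
  exact hle.trans_eq hs.tsum_eq.symm
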